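/- Let $\alpha\in(0,2)\setminus\{1\}$, let $p\in[1,\infty)$, let $E=\ell^p(\mathbb Z)$ be the space of complex $p$-summable sequences with canonical basis $(e_n)_{n\in\mathbb Z}$, and let $\langle\cdot,\cdot\rangle:E\times E^*\to\mathbb C$ be the (bilinear) duality pairing. Let $(\omega_n)_{n\in\mathbb Z}$ be positive weights and $k_0>0$ a constant such that the sequence $$k_n:=k_0\mathbf 1_{\{n\le -1\}}\prod_{l=n+1}^{0}\frac1{\omega_l}+k_0\mathbf 1_{\{n\ge 0\}}\prod_{l=1}^{n}\omega_l,\qquad n\in\mathbb Z,$$ belongs to $\ell^\alpha(\mathbb Z)$. Let $\mu$ be the $\alpha$-stable probability measure on $E$ with control measure $\xi=\frac12\sum_{n\in\mathbb Z}k_n^\alpha(\delta_{e_n}+\delta_{ie_n})$, i.e. the Borel probability measure such that $$\int_E e^{i\,\mathrm{Re}\langle z,x^*\rangle}\,\mu(dz)=\exp\Big(-\int_E|\mathrm{Re}\langle z,x^*\rangle|^\alpha\,\xi(dz)\Big),\qquad x^*\in E^*$$ (assumed to exist), and let $T$ be the weighted forward shift on $E$, i.e. the bounded linear operator with $Te_n=\omega_{n+1}e_{n+1}$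 for $n\in\mathbb Z$ (assumed to be bounded). For $x^*,y^*\in E^*$ put $$C^{=}_\mu(x^*,y^*):=\log\int_E e^{i\,\mathrm{Re}\langle z,x^*-y^*\rangle}\mu(dz)-\log\int_E e^{i\,\mathrm{Re}\langle z,x^*\rangle}\mu(dz)-\log\int_E e^{-i\,\mathrm{Re}\langle z,y^*\rangle}\mu(dz),$$ $$C^{\ne}_\mu(x^*,y^*):=\log\int_E e^{i\,\mathrm{Re}\langle z,x^*\rangle-i\,\mathrm{Im}\langle z,y^*\rangle}\mu(dz)-\log\int_E e^{i\,\mathrm{Re}\langle z,x^*\rangle}\mu(dz)-\log\int_E e^{-i\,\mathrm{Im}\langle z,y^*\rangle}\mu(dz).$$ 1. $T$ leaves $\mu$ invariant. 2. Assume moreover that $p\in(\alpha,2]\cap[1,2]$ and that there are integers $q_-\ge0$, $q_+\ge1$ such that $$\eta_-:=\sup_{l\le -q_-}\frac1{\omega_l}<1,\qquad \eta_+:=\sup_{l\ge q_+}\omega_l<1,\qquad \eta_+^{p/2}\ne\eta_-^{\alpha-p/2}.$$ Then there is a constant $K>0$, independent of $n$, $x^*$ and $y^*$, such that for each of $C_\mu=C^{=}_\mu$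 and $C_\mu=C^{\ne}_\mu$, $$\sup_{x^*,y^*\in E^*\setminus\{0\}}\frac{|C_\mu(x^*,T^{*n}y^*)|}{\|x^*\|^{\alpha/2}\|y^*\|^{\alpha/2}}\le K\,\max\big(\eta_-^{2\alpha/p-1},\eta_+\big)^{\alpha n/2},\qquad n\ge0.$$ In particular, if in addition $\alpha\in(1/2,2)\setminus\{1\}$ and $p\in(\alpha,2\alpha)\cap[1,2]$, then $T$ is mixing with respect to $\mu$, i.e. $T$ preserves $\mu$ and $\mu(A\cap T^{-n}(B))\to\mu(A)\mu(B)$ as $n\to\infty$ for all Borel sets $A,B\subset E$. -/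

import Mathlib

open MeasureTheory Filter Topology
open scoped NNReal ENNReal

noncomputable section

/-- The complex sequence space `ℓ^p(ℤ)`, with its usual norm. -/
abbrev EllP (p : ℝ≥0) : Type := lp (fun _ : ℤ => ℂ) (p : ℝ≥0∞)

/-- The canonical basis vector `e_n` of `ℓ^p(ℤ)`. -/
def basisVec (p : ℝ≥0) (n : ℤ) : EllP p := lp.single (p : ℝ≥0∞) n (1 : ℂ)

/-- The sequence built from the weights: `k_n = k₀ ∏_{l=n+1}^0 1/ω_l` for `n ≤ -1` and
`k_n = k₀ ∏_{l=1}^n ω_l` for `n ≥ 0`. -/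
def weightSeq (ω : ℤ → ℝ) (k₀ : ℝ) (n : ℤ) : ℝ :=
  if n ≤ -1 then k₀ * ∏ l ∈ Finset.Icc (n + 1) 0, 1 / ω l
  else k₀ * ∏ l ∈ Finset.Icc 1 n, ω l

/-- The control measure `½ ∑_n k_n^α (δ_{e_n} + δ_{i e_n})` on `ℓ^p(ℤ)`. -/
def controlMeasure (p : ℝ≥0) [MeasurableSpace (EllP p)] (α : ℝ) (k : ℤ → ℝ) :
    Measure (EllP p) :=
  Measure.sum fun n : ℤ => ENNReal.ofReal (k n ^ α / 2) •
    (Measure.dirac (basisVec p n) + Measure.dirac (Complex.I • basisVec p n))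

section Banach

variable {E : Type*} [NormedAddCommGroup E] [NormedSpace ℂ E] [MeasurableSpace E]

/-- `μ` is the (symmetric) `α`-stable measure with control measure `ξ`, i.e. its characteristic
functional is `x* ↦ exp (-∫ |Re ⟨z, x*⟩|^α ξ(dz))`. The dual pairing `⟨z, x*⟩` is `x* z`. -/
def IsStableWithControl (α : ℝ) (ξ μ : Measure E) : Prop :=
  ∀ x : StrongDual ℂ E,
    ∫ z, Complex.exp (Complex.I * ((x z).re : ℂ)) ∂μ
      = Complex.exp (-((∫ z, |(x z).re| ^ α ∂ξ : ℝ) : ℂ))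

/-- The codifference `C^=_μ(x*, y*)`. For the stable measures above all three characteristic
functionals are positive real numbers, so that the logarithm is the ordinary real one. -/
def codiffEq (μ : Measure E) (x y : StrongDual ℂ E) : ℂ :=
  Complex.log (∫ z, Complex.exp (Complex.I * (((x - y) z).re : ℂ)) ∂μ)
    - Complex.log (∫ z, Complex.exp (Complex.I * ((x z).re : ℂ)) ∂μ)
    - Complex.log (∫ z, Complex.exp (-(Complex.I * ((y z).re : ℂ))) ∂μ)

/-- The codifference `C^≠_μ(x*, y*)`. Since `Im ⟨z, y*⟩ = Re ⟨z, -i y*⟩`, the arguments of the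
logarithms are again positive real numbers for the stable measures above. -/
def codiffNe (μ : Measure E) (x y : StrongDual ℂ E) : ℂ :=
  Complex.log (∫ z, Complex.exp (Complex.I * ((x z).re : ℂ) - Complex.I * ((y z).im : ℂ)) ∂μ)
    - Complex.log (∫ z, Complex.exp (Complex.I * ((x z).re : ℂ)) ∂μ)
    - Complex.log (∫ z, Complex.exp (-(Complex.I * ((y z).im : ℂ))) ∂μ)

/-- The adjoint power `T^{*n} y*`, i.e. `⟨z, T^{*n} y*⟩ = ⟨T^n z, y*⟩`. -/
def adjPow (T : E →L[ℂ] E) (n : ℕ) (y : StrongDual ℂ E) : StrongDual ℂ E :=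
  y.comp (T ^ n)

/-- `T` is (strongly) mixing with respect to `μ`: it preserves `μ` and
`μ (A ∩ T^{-n} B) → μ A * μ B` for all measurable `A`, `B`. -/
structure IsMixing (T : E → E) (μ : Measure E) : Prop where
  measurePreserving : MeasurePreserving T μ μ
  tendsto : ∀ A B : Set E, MeasurableSet A → MeasurableSet B →
    Tendsto (fun n : ℕ => μ (A ∩ T^[n] ⁻¹' B)) atTop (𝓝 (μ A * μ B))

end Banach

end

/-!
The exponent of `μ` at a functional `x` is, up to the factor `1/2`, the sum over `n` of
`|Re x(k_n e_n)|^α + |Re x(i k_n e_n)|^α`, and `T` maps `k_n e_n` to `k_{n+1} e_{n+1}`; composing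
`x` with `T` only shifts the index of summation, so `T` preserves `μ`.

For `α ≤ 2` the inequality `| |a|^α + |b|^α - |a - b|^α | ≤ 2 |a|^(α/2) |b|^(α/2)` bounds the
codifference of `x` and `T^{*n} y` by a multiple of
`(‖x‖ ‖y‖)^(α/2) * ∑_m (k_m k_{m+n})^(α/2)`. Since `k` decays like `η₋^m` and `η₊^m` at `-∞` and
`+∞`, one has `k_m k_{m+n} ≤ C R^n t^|m|` with some `t < 1` as soon as `η₋ < R` and `η₊ ≤ R`. The
strict inequality leaves room to sum over the `n` indices `-n < m ≤ 0`, and it holds for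
`R = max (η₋^(2 * α / p - 1)) η₊` because `α < p`.

Finally, the characters `exp (i Re x)` span a dense subspace of `L²(μ)`, so the decay of all
codifferences already gives mixing.
-/

section Inequality

variable {F : Type*} [SeminormedAddCommGroup F]

theorem norm_add_rpow_le {s : ℝ} (hs0 : 0 ≤ s) (hs1 : s ≤ 1) (a b : F) :
    ‖a + b‖ ^ s ≤ ‖a‖ ^ s + ‖b‖ ^ s :=
  (Real.rpow_le_rpow (norm_nonneg _) (norm_add_le a b) hs0).trans
    (Real.rpow_add_le_add_rpow (norm_nonneg a) (norm_nonneg b) hs0 hs1)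

theorem abs_norm_rpow_add_sub_norm_sub_rpow_le {α : ℝ} (h0 : 0 ≤ α) (h2 : α ≤ 2) (a b : F) :
    |(‖a‖ ^ α + ‖b‖ ^ α - ‖a - b‖ ^ α)| ≤ 2 * (‖a‖ ^ (α / 2) * ‖b‖ ^ (α / 2)) := by
  have hs0 : 0 ≤ α / 2 := by positivity
  have hs1 : α / 2 ≤ 1 := by linarith
  have hsq (c : F) : ‖c‖ ^ α = (‖c‖ ^ (α / 2)) ^ 2 := by
    rw [← Real.rpow_mul_natCast (norm_nonneg c), Nat.cast_ofNat, div_mul_cancel₀ _ two_ne_zero]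
  have hA : ‖a‖ ^ (α / 2) ≤ ‖a - b‖ ^ (α / 2) + ‖b‖ ^ (α / 2) := by
    simpa using norm_add_rpow_le hs0 hs1 (a - b) b
  have hB : ‖b‖ ^ (α / 2) ≤ ‖a - b‖ ^ (α / 2) + ‖a‖ ^ (α / 2) := by
    simpa [norm_sub_rev b a] using norm_add_rpow_le hs0 hs1 (b - a) a
  have hD : ‖a - b‖ ^ (α / 2) ≤ ‖a‖ ^ (α / 2) + ‖b‖ ^ (α / 2) := by
    simpa [sub_eq_add_neg] using norm_add_rpow_le hs0 hs1 a (-b)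
  have hlower : (‖a‖ ^ (α / 2) - ‖b‖ ^ (α / 2)) ^ 2 ≤ (‖a - b‖ ^ (α / 2)) ^ 2 :=
    sq_le_sq' (by linarith) (by linarith)
  have hupper : (‖a - b‖ ^ (α / 2)) ^ 2 ≤ (‖a‖ ^ (α / 2) + ‖b‖ ^ (α / 2)) ^ 2 := by gcongr
  rw [hsq a, hsq b, hsq (a - b), abs_le]
  constructor <;> linarith

end Inequality

section Character

variable {E : Type*} [NormedAddCommGroup E] [NormedSpace ℂ E]

/-- The character `z ↦ exp (i Re ⟨z, x⟩)` of `E` attached to a functional `x`. -/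
noncomputable def character (x : StrongDual ℂ E) (z : E) : ℂ :=
  Complex.exp (Complex.I * ((x z).re : ℂ))

@[simp]
theorem character_zero (z : E) : character (0 : StrongDual ℂ E) z = 1 := by
  simp [character]

theorem character_add (x y : StrongDual ℂ E) (z : E) :
    character (x + y) z = character x z * character y z := by
  simp [character, mul_add, Complex.exp_add]

theorem conj_character (x : StrongDual ℂ E) (z : E) :
    starRingEnd ℂ (character x z) = character (-x) z := by
  simp [character, ← Complex.exp_conj]

@[simp]
theorem norm_character (x : StrongDual ℂ E) (z : E) : ‖character x z‖ = 1 :=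
  Complex.norm_exp_I_mul_ofReal _

@[fun_prop]
theorem continuous_character (x : StrongDual ℂ E) : Continuous (character x) := by
  unfold character
  fun_prop

variable [MeasurableSpace E]

/-- The characteristic functional of `μ`, as a function on the complex dual (Mathlib's
`charFunDual` is defined on the real dual). -/
noncomputable def charFunctional (μ : Measure E) (x : StrongDual ℂ E) : ℂ :=
  ∫ z, character x z ∂μ

theorem codiffEq_eq_log_charFunctional (μ : Measure E) (x y : StrongDual ℂ E) :
    codiffEq μ x y = Complex.log (charFunctional μ (x - y)) - Complex.log (charFunctional μ x)
      - Complex.log (charFunctional μ (-y)) := by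
  simp [codiffEq, charFunctional, character]

theorem codiffNe_eq_codiffEq (μ : Measure E) (x y : StrongDual ℂ E) :
    codiffNe μ x y = codiffEq μ x (-(Complex.I • y)) := by
  simp [codiffNe, codiffEq, sub_eq_add_neg, mul_add]

variable [BorelSpace E]

theorem memLp_character (q : ℝ≥0∞) (μ : Measure E) [IsFiniteMeasure μ] (x : StrongDual ℂ E) :
    MemLp (character x) q μ :=
  .of_bound (continuous_character x).measurable.aestronglyMeasurable 1
    (ae_of_all _ fun z => (norm_character x z).le)

theorem integrable_mul_character {μ : Measure E} {f : E → ℂ} (hf : Integrable f μ)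
    (x : StrongDual ℂ E) : Integrable (fun z => f z * character x z) μ :=
  hf.mul_bdd (c := 1) (continuous_character x).measurable.aestronglyMeasurable
    (ae_of_all _ fun z => (norm_character x z).le)

variable [CompleteSpace E] [SecondCountableTopology E]

theorem ext_of_charFunctional {μ ν : Measure E} [IsFiniteMeasure μ] [IsFiniteMeasure ν]
    (h : charFunctional μ = charFunctional ν) : μ = ν := by
  let : NormedSpace ℝ E := NormedSpace.restrictScalars ℝ ℂ E
  refine Measure.ext_of_charFunDual (funext fun L => ?_)
  have hre (z : E) : (L.extendRCLike (𝕜 := ℂ) z).re = L z := by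
    simp [StrongDual.extendRCLike_apply]
  simpa only [charFunctional, character, charFunDual_apply, hre, mul_comm Complex.I]
    using congrFun h (L.extendRCLike (𝕜 := ℂ))

theorem integral_withDensity_ofReal {Ω : Type*} [MeasurableSpace Ω] {μ : Measure Ω} {u : Ω → ℝ}
    (hu : AEMeasurable u μ) (g : Ω → ℂ) :
    ∫ z, g z ∂μ.withDensity (fun z => ENNReal.ofReal (u z)) = ∫ z, (u z)⁺ * g z ∂μ := by
  rw [integral_withDensity_eq_integral_toReal_smul₀ hu.ennreal_ofReal (by simp)]
  simp [ENNReal.toReal_ofReal', posPart_def, Complex.real_smul]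

theorem ae_eq_zero_of_integral_ofReal_mul_character {μ : Measure E} [IsFiniteMeasure μ]
    {u : E → ℝ} (hu : Integrable u μ)
    (h : ∀ x : StrongDual ℂ E, ∫ z, (u z : ℂ) * character x z ∂μ = 0) : u =ᵐ[μ] 0 := by
  have hpos := isFiniteMeasure_withDensity_ofReal hu.2
  have hneg := isFiniteMeasure_withDensity_ofReal hu.neg.2
  have hν : μ.withDensity (fun z => ENNReal.ofReal (u z))
      = μ.withDensity fun z => ENNReal.ofReal ((-u) z) := by
    refine ext_of_charFunctional (funext fun x => ?_)
    rw [charFunctional, charFunctional, integral_withDensity_ofReal hu.aemeasurable,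
      integral_withDensity_ofReal hu.neg.aemeasurable, ← sub_eq_zero, ← integral_sub, ← h x]
    · refine integral_congr_ae (ae_of_all _ fun z => ?_)
      simp only [Pi.neg_apply, posPart_neg, ← sub_mul, ← Complex.ofReal_sub,
        posPart_sub_negPart]
    · exact integrable_mul_character hu.pos_part.ofReal x
    · exact integrable_mul_character hu.neg.pos_part.ofReal x
  have hint : ∫⁻ z, ENNReal.ofReal (u z) ∂μ ≠ ∞ := by
    simpa using hpos.measure_univ_lt_top.ne
  filter_upwards [(withDensity_eq_iff hu.aemeasurable.ennreal_ofReal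
    hu.neg.aemeasurable.ennreal_ofReal hint).1 hν] with z hz
  have hz' : (u z)⁺ = (u z)⁻ := by
    simpa [ENNReal.toReal_ofReal', posPart_def, negPart_def] using congrArg ENNReal.toReal hz
  rw [← posPart_sub_negPart (u z), hz', sub_self, Pi.zero_apply]

theorem ae_eq_zero_of_integral_mul_character {μ : Measure E} [IsFiniteMeasure μ]
    {f : E → ℂ} (hf : Integrable f μ)
    (h : ∀ x : StrongDual ℂ E, ∫ z, f z * character x z ∂μ = 0) : f =ᵐ[μ] 0 := by
  have hconj (x : StrongDual ℂ E) : ∫ z, starRingEnd ℂ (f z) * character x z ∂μ = 0 := by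
    simpa [← integral_conj, conj_character] using congrArg (starRingEnd ℂ) (h (-x))
  have hf' : Integrable (fun z => starRingEnd ℂ (f z)) μ :=
    (Complex.conjCLE : ℂ →L[ℝ] ℂ).integrable_comp hf
  have hre : (fun z => (f z).re) =ᵐ[μ] 0 := by
    refine ae_eq_zero_of_integral_ofReal_mul_character hf.re fun x => ?_
    simp_rw [Complex.re_eq_add_conj, div_mul_eq_mul_div, add_mul]
    rw [integral_div, integral_add (integrable_mul_character hf x)
      (integrable_mul_character hf' x), h, hconj, add_zero, zero_div]
  have him : (fun z => (f z).im) =ᵐ[μ] 0 := by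
    refine ae_eq_zero_of_integral_ofReal_mul_character hf.im fun x => ?_
    simp_rw [Complex.im_eq_sub_conj, div_mul_eq_mul_div, sub_mul]
    rw [integral_div, integral_sub (integrable_mul_character hf x)
      (integrable_mul_character hf' x), h, hconj, sub_zero, zero_div]
  filter_upwards [hre, him] with z hz1 hz2 using Complex.ext hz1 hz2

end Character

section WeakLimit

variable {𝕜 H G ι : Type*} [RCLike 𝕜] [NormedAddCommGroup H] [NormedAddCommGroup G]

theorem tendsto_of_topologicalClosure_span_eq_top [NormedSpace 𝕜 H] [NormedSpace 𝕜 G]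
    {l : Filter ι} {S : Set H} (hS : (Submodule.span 𝕜 S).topologicalClosure = ⊤)
    {φ : ι → H →L[𝕜] G} {ψ : H →L[𝕜] G} {C : ℝ≥0} (hC : ∀ i, ‖φ i‖₊ ≤ C)
    (h : ∀ f ∈ S, Tendsto (fun i => φ i f) l (𝓝 (ψ f))) (f : H) :
    Tendsto (fun i => φ i f) l (𝓝 (ψ f)) := by
  have hequi : Equicontinuous fun i => (φ i : H → G) :=
    (LipschitzWith.uniformEquicontinuous _ C
      fun i => (φ i).lipschitz.weaken (hC i)).equicontinuous
  have hspan : ∀ g ∈ Submodule.span 𝕜 S, Tendsto (fun i => φ i g) l (𝓝 (ψ g)) := by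
    intro g hg
    induction hg using Submodule.span_induction with
    | mem x hx => exact h x hx
    | zero => simp [tendsto_const_nhds]
    | add x y _ _ hx hy => simpa using hx.add hy
    | smul a x _ hx => simpa using hx.const_smul a
  have hf : f ∈ (Submodule.span 𝕜 S).topologicalClosure := hS ▸ Submodule.mem_top
  exact closure_minimal hspan (hequi.isClosed_setOfPred_tendsto ψ.continuous) hf

theorem tendsto_inner_of_topologicalClosure_span_eq_top [InnerProductSpace 𝕜 H]
    {l : Filter ι} {S : Set H} (hS : (Submodule.span 𝕜 S).topologicalClosure = ⊤)
    {V : ι → H →L[𝕜] H} {W : H →L[𝕜] H} {C : ℝ≥0} (hC : ∀ i, ‖V i‖₊ ≤ C)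
    (h : ∀ f ∈ S, ∀ g ∈ S, Tendsto (fun i => inner 𝕜 f (V i g)) l (𝓝 (inner 𝕜 f (W g))))
    (f g : H) : Tendsto (fun i => inner 𝕜 f (V i g)) l (𝓝 (inner 𝕜 f (W g))) := by
  have hleft (f : H) (g : H) (hg : g ∈ S) :
      Tendsto (fun i => inner 𝕜 f (V i g)) l (𝓝 (inner 𝕜 f (W g))) := by
    have hbound (i : ι) : ‖innerSL 𝕜 (V i g)‖₊ ≤ C * ‖g‖₊ := by
      refine (innerSL_apply_norm (𝕜 := 𝕜) (V i g)).le.trans ?_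
      exact (V i).le_of_opNorm_le (hC i) g
    have hconj := tendsto_of_topologicalClosure_span_eq_top hS (l := l) hbound
      (ψ := innerSL 𝕜 (W g)) (fun f hf => by
        simpa [Function.comp_def] using
          ((RCLike.continuous_conj (K := 𝕜)).tendsto _).comp (h f hf g hg)) f
    simpa [Function.comp_def] using ((RCLike.continuous_conj (K := 𝕜)).tendsto _).comp hconj
  have hbound (i : ι) : ‖(innerSL 𝕜 f).comp (V i)‖₊ ≤ ‖f‖₊ * C := by
    refine (ContinuousLinearMap.opNorm_comp_le _ _).trans ?_
    rw [innerSL_apply_norm]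
    exact mul_le_mul_of_nonneg_left (hC i) (norm_nonneg f)
  exact tendsto_of_topologicalClosure_span_eq_top hS hbound
    (ψ := (innerSL 𝕜 f).comp W) (fun g hg => hleft f g hg) g

end WeakLimit

section Mixing

variable {E : Type*} [NormedAddCommGroup E] [NormedSpace ℂ E] [MeasurableSpace E] [BorelSpace E]

/-- The character `z ↦ exp (i Re ⟨z, x⟩)` as an element of `L²(μ)`. -/
noncomputable def charLp (μ : Measure E) [IsFiniteMeasure μ] (x : StrongDual ℂ E) : Lp ℂ 2 μ :=
  (memLp_character 2 μ x).toLp _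

theorem charLp_zero (μ : Measure E) [IsFiniteMeasure μ] :
    charLp μ 0 = indicatorConstLp 2 .univ (measure_ne_top μ _) 1 := by
  simp only [charLp, indicatorConstLp]
  congr
  ext z
  simp

theorem inner_charLp (μ : Measure E) [IsFiniteMeasure μ] (x : StrongDual ℂ E) (f : Lp ℂ 2 μ) :
    inner ℂ (charLp μ x) f = ∫ z, f z * character (-x) z ∂μ := by
  rw [L2.inner_def]
  refine integral_congr_ae ?_
  filter_upwards [(memLp_character 2 μ x).coeFn_toLp] with z hz
  rw [charLp, hz, RCLike.inner_apply, conj_character]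

theorem inner_charLp_charLp (μ : Measure E) [IsFiniteMeasure μ] (x y : StrongDual ℂ E) :
    inner ℂ (charLp μ x) (charLp μ y) = charFunctional μ (y - x) := by
  rw [inner_charLp]
  refine integral_congr_ae ?_
  filter_upwards [(memLp_character 2 μ y).coeFn_toLp] with z hz
  rw [charLp, hz, sub_eq_add_neg, character_add]

theorem compMeasurePreserving_charLp {μ : Measure E} [IsFiniteMeasure μ] {T : E →L[ℂ] E}
    (n : ℕ) (hT : MeasurePreserving T^[n] μ μ) (x : StrongDual ℂ E) :
    Lp.compMeasurePreserving T^[n] hT (charLp μ x) = charLp μ (adjPow T n x) := by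
  rw [charLp, Lp.toLp_compMeasurePreserving, charLp]
  congr
  ext z
  simp [character, adjPow]

theorem charFunctional_adjPow {μ : Measure E} {T : E →L[ℂ] E}
    (hT : MeasurePreserving T μ μ) (n : ℕ) (x : StrongDual ℂ E) :
    charFunctional μ (adjPow T n x) = charFunctional μ x := by
  have h := integral_map (hT.iterate n).aemeasurable
    (continuous_character x).measurable.aestronglyMeasurable
  rw [(hT.iterate n).map_eq] at h
  simpa [charFunctional, character, adjPow] using h.symm

variable [CompleteSpace E] [SecondCountableTopology E]

theorem measurePreserving_of_charFunctional_comp {μ : Measure E} [IsFiniteMeasure μ]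
    {T : E →L[ℂ] E} (h : ∀ x, charFunctional μ (x.comp T) = charFunctional μ x) :
    MeasurePreserving T μ μ := by
  have hT : Measurable T := T.continuous.measurable
  refine ⟨hT, ext_of_charFunctional (funext fun x => ?_)⟩
  rw [← h, charFunctional, integral_map hT.aemeasurable
    (continuous_character x).measurable.aestronglyMeasurable]
  rfl

theorem topologicalClosure_span_range_charLp (μ : Measure E) [IsFiniteMeasure μ] :
    (Submodule.span ℂ (Set.range (charLp μ))).topologicalClosure = ⊤ := by
  rw [Submodule.topologicalClosure_eq_top_iff, Submodule.eq_bot_iff]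
  intro f hf
  refine (Lp.eq_zero_iff_ae_eq_zero).2 <| ae_eq_zero_of_integral_mul_character
    ((Lp.memLp f).integrable one_le_two) fun x => ?_
  rw [← neg_neg x, ← inner_charLp]
  exact (Submodule.mem_orthogonal _ _).1 hf _ (Submodule.subset_span ⟨_, rfl⟩)

theorem tendsto_inner_compMeasurePreserving {μ : Measure E} [IsProbabilityMeasure μ]
    {T : E →L[ℂ] E} (hT : MeasurePreserving T μ μ)
    (h : ∀ x y : StrongDual ℂ E, Tendsto (fun n => charFunctional μ (x + adjPow T n y)) atTop
      (𝓝 (charFunctional μ x * charFunctional μ y))) (f g : Lp ℂ 2 μ) :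
    Tendsto (fun n => inner ℂ f (Lp.compMeasurePreserving T^[n] (hT.iterate n) g)) atTop
      (𝓝 (inner ℂ f (charLp μ 0) * inner ℂ (charLp μ 0) g)) := by
  let koopman (n : ℕ) : Lp ℂ 2 μ →ₗᵢ[ℂ] Lp ℂ 2 μ :=
    Lp.compMeasurePreservingₗᵢ ℂ T^[n] (hT.iterate n)
  let mean : Lp ℂ 2 μ →L[ℂ] Lp ℂ 2 μ := (innerSL ℂ (charLp μ 0)).smulRight (charLp μ 0)
  have hmean (f g : Lp ℂ 2 μ) :
      inner ℂ f (mean g) = inner ℂ f (charLp μ 0) * inner ℂ (charLp μ 0) g := by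
    simp [mean, inner_smul_right, mul_comm]
  have hchar (x y : StrongDual ℂ E) :
      Tendsto (fun n => inner ℂ (charLp μ x) (koopman n (charLp μ y))) atTop
        (𝓝 (inner ℂ (charLp μ x) (mean (charLp μ y)))) := by
    have hkoopman (n : ℕ) : koopman n (charLp μ y) = charLp μ (adjPow T n y) :=
      compMeasurePreserving_charLp n (hT.iterate n) y
    simpa [hkoopman, hmean, inner_charLp_charLp, sub_eq_add_neg, add_comm] using h (-x) y
  rw [← hmean]
  refine tendsto_inner_of_topologicalClosure_span_eq_top (topologicalClosure_span_range_charLp μ)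
    (V := fun n => (koopman n).toContinuousLinearMap) (C := 1)
    (fun n => (koopman n).norm_toContinuousLinearMap_le) ?_ f g
  rintro _ ⟨x, rfl⟩ _ ⟨y, rfl⟩
  exact hchar x y

theorem isMixing_of_tendsto_charFunctional {μ : Measure E} [IsProbabilityMeasure μ]
    {T : E →L[ℂ] E} (hT : MeasurePreserving T μ μ)
    (h : ∀ x y : StrongDual ℂ E, Tendsto (fun n => charFunctional μ (x + adjPow T n y)) atTop
      (𝓝 (charFunctional μ x * charFunctional μ y))) : IsMixing T μ := by
  refine ⟨hT, fun A B hA hB => ?_⟩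
  have hlim := tendsto_inner_compMeasurePreserving hT h
    (indicatorConstLp 2 hA (measure_ne_top μ A) 1) (indicatorConstLp 2 hB (measure_ne_top μ B) 1)
  simp only [Lp.indicatorConstLp_compMeasurePreserving, charLp_zero,
    L2.inner_indicatorConstLp_one_indicatorConstLp_one, Set.inter_univ, Set.univ_inter] at hlim
  have hreal : Tendsto (fun n => μ.real (A ∩ T^[n] ⁻¹' B)) atTop (𝓝 (μ.real A * μ.real B)) := by
    rw [← tendsto_ofReal_iff]
    exact_mod_cast hlim
  simpa [ENNReal.ofReal_mul measureReal_nonneg] using ENNReal.tendsto_ofReal hreal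

theorem isMixing_of_tendsto_codiffEq {μ : Measure E} [IsProbabilityMeasure μ]
    {T : E →L[ℂ] E} (hT : MeasurePreserving T μ μ) (hμ : ∀ x, charFunctional μ x ≠ 0)
    (h : ∀ x y : StrongDual ℂ E, Tendsto (fun n => codiffEq μ x (adjPow T n y)) atTop (𝓝 0)) :
    IsMixing T μ := by
  have hexp (x y : StrongDual ℂ E) :
      Complex.exp (codiffEq μ x y) * (charFunctional μ x * charFunctional μ (-y))
        = charFunctional μ (x - y) := by
    rw [codiffEq_eq_log_charFunctional, Complex.exp_sub, Complex.exp_sub,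
      Complex.exp_log (hμ _), Complex.exp_log (hμ _), Complex.exp_log (hμ _)]
    field_simp [hμ]
  refine isMixing_of_tendsto_charFunctional hT fun x y => ?_
  have hneg (n : ℕ) : adjPow T n (-y) = -adjPow T n y := ContinuousLinearMap.neg_comp _ _
  have hlim := (h x (-y)).cexp.mul_const (charFunctional μ x * charFunctional μ y)
  rw [Complex.exp_zero, one_mul] at hlim
  refine hlim.congr fun n => ?_
  rw [← charFunctional_adjPow hT n y, ← neg_neg (adjPow T n y), ← hneg, hexp,
    sub_eq_add_neg]

end Mixing

section Stable

variable {E : Type*} [NormedAddCommGroup E] [NormedSpace ℂ E] [MeasurableSpace E] {α : ℝ}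
  {ξ μ : Measure E}

/-- The exponent `∫ |Re ⟨z, x⟩|^α ξ(dz)` of the `α`-stable measure with control measure `ξ`. -/
noncomputable def stableExponent (α : ℝ) (ξ : Measure E) (x : StrongDual ℂ E) : ℝ :=
  ∫ z, |(x z).re| ^ α ∂ξ

theorem stableExponent_neg (x : StrongDual ℂ E) :
    stableExponent α ξ (-x) = stableExponent α ξ x := by
  simp [stableExponent]

theorem IsStableWithControl.charFunctional_eq (hμ : IsStableWithControl α ξ μ)
    (x : StrongDual ℂ E) : charFunctional μ x = (Real.exp (-stableExponent α ξ x) : ℂ) := by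
  rw [Complex.ofReal_exp, Complex.ofReal_neg]
  exact hμ x

theorem IsStableWithControl.charFunctional_ne_zero (hμ : IsStableWithControl α ξ μ)
    (x : StrongDual ℂ E) : charFunctional μ x ≠ 0 := by
  rw [hμ.charFunctional_eq]
  exact_mod_cast (Real.exp_pos _).ne'

theorem IsStableWithControl.codiffEq_eq (hμ : IsStableWithControl α ξ μ)
    (x y : StrongDual ℂ E) :
    codiffEq μ x y
      = ((stableExponent α ξ x + stableExponent α ξ y - stableExponent α ξ (x - y) : ℝ) : ℂ) := by
  have hlog (x : StrongDual ℂ E) :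
      Complex.log (charFunctional μ x) = ((-stableExponent α ξ x : ℝ) : ℂ) := by
    rw [hμ.charFunctional_eq, ← Complex.ofReal_log (Real.exp_pos _).le, Real.log_exp]
  rw [codiffEq_eq_log_charFunctional, hlog, hlog, hlog, stableExponent_neg]
  push_cast
  ring

theorem IsStableWithControl.norm_codiffEq_le (hμ : IsStableWithControl α ξ μ)
    (h0 : 0 ≤ α) (h2 : α ≤ 2)
    (hint : ∀ x : StrongDual ℂ E, Integrable (fun z => |(x z).re| ^ α) ξ)
    {x y : StrongDual ℂ E}
    (hxy : Integrable (fun z => |(x z).re| ^ (α / 2) * |(y z).re| ^ (α / 2)) ξ) :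
    ‖codiffEq μ x y‖ ≤ 2 * ∫ z, |(x z).re| ^ (α / 2) * |(y z).re| ^ (α / 2) ∂ξ := by
  have hexp : stableExponent α ξ x + stableExponent α ξ y - stableExponent α ξ (x - y)
      = ∫ z, (|(x z).re| ^ α + |(y z).re| ^ α - |((x - y) z).re| ^ α) ∂ξ := by
    rw [integral_sub (f := fun z => |(x z).re| ^ α + |(y z).re| ^ α) ((hint x).add (hint y))
      (hint (x - y)), integral_add (hint x) (hint y)]
    rfl
  rw [hμ.codiffEq_eq, Complex.norm_real, hexp, ← integral_const_mul]
  refine norm_integral_le_of_norm_le (hxy.const_mul 2) (ae_of_all _ fun z => ?_)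
  simpa using abs_norm_rpow_add_sub_norm_sub_rpow_le h0 h2 (x z).re (y z).re

end Stable

section ControlMeasure

theorem separableSpace_lp {ι : Type*} [Countable ι] {F : ι → Type*}
    [∀ i, NormedAddCommGroup (F i)] [∀ i, TopologicalSpace.SeparableSpace (F i)] {q : ℝ≥0∞}
    [Fact (1 ≤ q)] (hq : q ≠ ∞) : TopologicalSpace.SeparableSpace (lp F q) := by
  classical
  have hsingle : TopologicalSpace.IsSeparable (⋃ i, Set.range (lp.single (E := F) q i)) :=
    .iUnion fun i => TopologicalSpace.isSeparable_range (lp.isometry_single i).continuous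
  refine TopologicalSpace.isSeparable_univ_iff.1
    ((hsingle.span (R := ℤ)).closure.mono fun f _ => ?_)
  exact mem_closure_of_tendsto (lp.hasSum_single hq f) (.of_forall fun s =>
    Submodule.sum_mem _ fun i _ => Submodule.subset_span (Set.mem_iUnion.2 ⟨i, ⟨f i, rfl⟩⟩))

variable {p : ℝ≥0} {α : ℝ} {k : ℤ → ℝ}

/-- The weighted basis vector `k_n e_n`, which absorbs the weight `k_n^α` of the control measure
for integrands that are homogeneous of degree `α`. -/
noncomputable def weightedBasisVec (p : ℝ≥0) (k : ℤ → ℝ) (n : ℤ) : EllP p :=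
  (k n : ℂ) • basisVec p n

variable [Fact (1 ≤ (p : ℝ≥0∞))]

instance : TopologicalSpace.SeparableSpace (EllP p) :=
  separableSpace_lp ENNReal.coe_ne_top

theorem norm_apply_weightedBasisVec_le (hk0 : ∀ n, 0 ≤ k n) (x : StrongDual ℂ (EllP p))
    (n : ℤ) : ‖x (weightedBasisVec p k n)‖ ≤ k n * ‖x‖ := by
  refine (x.le_opNorm _).trans_eq ?_
  rw [weightedBasisVec, basisVec, norm_smul, lp.norm_single (zero_lt_one.trans_le Fact.out),
    norm_one, mul_one, Complex.norm_real, Real.norm_of_nonneg (hk0 n), mul_comm]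

variable [MeasurableSpace (EllP p)] [BorelSpace (EllP p)] {f : EllP p → ℝ}

theorem integral_smul_dirac_basisVec (hk0 : ∀ n, 0 ≤ k n)
    (hf : ∀ c : ℝ, 0 ≤ c → ∀ z, f ((c : ℂ) • z) = c ^ α * f z) (n : ℤ) :
    ∫ z, f z ∂(ENNReal.ofReal (k n ^ α / 2) •
        (Measure.dirac (basisVec p n) + Measure.dirac (Complex.I • basisVec p n)))
      = (f (weightedBasisVec p k n) + f (Complex.I • weightedBasisVec p k n)) / 2 := by
  rw [integral_smul_measure, integral_add_measure (integrable_dirac (by simp))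
    (integrable_dirac (by simp)), integral_dirac, integral_dirac, smul_eq_mul,
    ENNReal.toReal_ofReal (div_nonneg (Real.rpow_nonneg (hk0 n) α) two_pos.le),
    weightedBasisVec, smul_comm Complex.I, hf _ (hk0 n), hf _ (hk0 n)]
  ring

theorem integrable_controlMeasure (hk0 : ∀ n, 0 ≤ k n)
    (hf : ∀ c : ℝ, 0 ≤ c → ∀ z, f ((c : ℂ) • z) = c ^ α * f z) {b : ℤ → ℝ}
    (hb : ∀ n, ‖f (weightedBasisVec p k n)‖ ≤ b n)
    (hbI : ∀ n, ‖f (Complex.I • weightedBasisVec p k n)‖ ≤ b n) (hsum : Summable b) :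
    Integrable f (controlMeasure p α k) := by
  have hnorm (c : ℝ) (hc : 0 ≤ c) (z : EllP p) : ‖f ((c : ℂ) • z)‖ = c ^ α * ‖f z‖ := by
    rw [hf c hc, norm_mul, Real.norm_of_nonneg (Real.rpow_nonneg hc α)]
  refine integrable_sum_measure (fun n => ?_) ?_
  · exact (Integrable.add_measure (integrable_dirac (by simp))
      (integrable_dirac (by simp))).smul_measure ENNReal.ofReal_ne_top
  · simp only [integral_smul_dirac_basisVec (f := fun z => ‖f z‖) hk0 hnorm]
    exact hsum.of_nonneg_of_le (fun n => by positivity) fun n => by linarith [hb n, hbI n]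

theorem integral_controlMeasure (hk0 : ∀ n, 0 ≤ k n)
    (hf : ∀ c : ℝ, 0 ≤ c → ∀ z, f ((c : ℂ) • z) = c ^ α * f z)
    (hint : Integrable f (controlMeasure p α k)) :
    ∫ z, f z ∂controlMeasure p α k
      = ∑' n, (f (weightedBasisVec p k n) + f (Complex.I • weightedBasisVec p k n)) / 2 := by
  rw [controlMeasure] at hint ⊢
  simp_rw [integral_sum_measure hint, integral_smul_dirac_basisVec hk0 hf]

theorem integral_controlMeasure_le (hk0 : ∀ n, 0 ≤ k n)
    (hf : ∀ c : ℝ, 0 ≤ c → ∀ z, f ((c : ℂ) • z) = c ^ α * f z) {b : ℤ → ℝ}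
    (hb : ∀ n, ‖f (weightedBasisVec p k n)‖ ≤ b n)
    (hbI : ∀ n, ‖f (Complex.I • weightedBasisVec p k n)‖ ≤ b n) (hsum : Summable b) :
    ∫ z, f z ∂controlMeasure p α k ≤ ∑' n, b n := by
  rw [integral_controlMeasure hk0 hf (integrable_controlMeasure hk0 hf hb hbI hsum)]
  refine (Real.le_norm_self _).trans (tsum_of_norm_bounded hsum.hasSum fun n => ?_)
  rw [norm_div, Real.norm_ofNat]
  linarith [norm_add_le (f (weightedBasisVec p k n)) (f (Complex.I • weightedBasisVec p k n)),
    hb n, hbI n]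

theorem abs_re_apply_smul_rpow {F : Type*} [NormedAddCommGroup F] [NormedSpace ℂ F]
    (x : StrongDual ℂ F) (s : ℝ) {c : ℝ} (hc : 0 ≤ c) (z : F) :
    |(x ((c : ℂ) • z)).re| ^ s = c ^ s * |(x z).re| ^ s := by
  rw [map_smul, smul_eq_mul, Complex.re_ofReal_mul, abs_mul, abs_of_nonneg hc,
    Real.mul_rpow hc (abs_nonneg _)]

theorem integrable_abs_re_rpow_controlMeasure (h0 : 0 ≤ α) (hk0 : ∀ n, 0 ≤ k n)
    (hk : Summable fun n => k n ^ α) (x : StrongDual ℂ (EllP p)) :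
    Integrable (fun z => |(x z).re| ^ α) (controlMeasure p α k) := by
  have hbound (n : ℤ) (u : EllP p) (hu : ‖x u‖ ≤ k n * ‖x‖) :
      ‖|(x u).re| ^ α‖ ≤ k n ^ α * ‖x‖ ^ α := by
    rw [Real.norm_of_nonneg (by positivity), ← Real.mul_rpow (hk0 n) (norm_nonneg x)]
    exact Real.rpow_le_rpow (abs_nonneg _) ((Complex.abs_re_le_norm _).trans hu) h0
  have hx (n : ℤ) := norm_apply_weightedBasisVec_le hk0 x n
  exact integrable_controlMeasure hk0 (fun c hc z => abs_re_apply_smul_rpow x α hc z)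
    (fun n => hbound n _ (hx n)) (fun n => hbound n _ (by simpa using hx n))
    (hk.mul_right (‖x‖ ^ α))

theorem stableExponent_controlMeasure (h0 : 0 ≤ α) (hk0 : ∀ n, 0 ≤ k n)
    (hk : Summable fun n => k n ^ α) (x : StrongDual ℂ (EllP p)) :
    stableExponent α (controlMeasure p α k) x = ∑' n, (|(x (weightedBasisVec p k n)).re| ^ α
      + |(x (Complex.I • weightedBasisVec p k n)).re| ^ α) / 2 :=
  integral_controlMeasure hk0 (fun _ hc z => abs_re_apply_smul_rpow x α hc z)
    (integrable_abs_re_rpow_controlMeasure h0 hk0 hk x)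

theorem IsStableWithControl.norm_codiffEq_le_tsum {μ : Measure (EllP p)}
    (hμ : IsStableWithControl α (controlMeasure p α k) μ) (h0 : 0 ≤ α) (h2 : α ≤ 2)
    (hk0 : ∀ n, 0 ≤ k n) (hk : Summable fun n => k n ^ α) {x y : StrongDual ℂ (EllP p)}
    {b : ℤ → ℝ} (hb : ∀ n, ‖x (weightedBasisVec p k n)‖ * ‖y (weightedBasisVec p k n)‖ ≤ b n)
    (hsum : Summable fun n => b n ^ (α / 2)) :
    ‖codiffEq μ x y‖ ≤ 2 * ∑' n, b n ^ (α / 2) := by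
  have hhom (c : ℝ) (hc : 0 ≤ c) (z : EllP p) :
      |(x ((c : ℂ) • z)).re| ^ (α / 2) * |(y ((c : ℂ) • z)).re| ^ (α / 2)
        = c ^ α * (|(x z).re| ^ (α / 2) * |(y z).re| ^ (α / 2)) := by
    rw [abs_re_apply_smul_rpow x _ hc, abs_re_apply_smul_rpow y _ hc, mul_mul_mul_comm,
      ← Real.rpow_add_of_nonneg hc (by positivity) (by positivity), add_halves]
  have hbound (n : ℤ) (u : EllP p) (hu : ‖x u‖ * ‖y u‖ ≤ b n) :
      ‖|(x u).re| ^ (α / 2) * |(y u).re| ^ (α / 2)‖ ≤ b n ^ (α / 2) := by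
    rw [Real.norm_of_nonneg (by positivity), ← Real.mul_rpow (abs_nonneg _) (abs_nonneg _)]
    refine Real.rpow_le_rpow (by positivity) (le_trans ?_ hu) (by positivity)
    gcongr <;> exact Complex.abs_re_le_norm _
  have hw (n : ℤ) := hbound n _ (hb n)
  have hwI (n : ℤ) := hbound n (Complex.I • weightedBasisVec p k n) (by simpa using hb n)
  refine (hμ.norm_codiffEq_le h0 h2 (integrable_abs_re_rpow_controlMeasure h0 hk0 hk)
    (integrable_controlMeasure hk0 hhom hw hwI hsum)).trans ?_
  gcongr
  exact integral_controlMeasure_le hk0 hhom hw hwI hsum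

end ControlMeasure

section Weights

theorem exists_pos_forall_le_mul_pow {u : ℕ → ℝ} (hu : ∀ j, 0 ≤ u j) {a : ℝ} (ha : 0 < a)
    (h : ∀ᶠ j in atTop, u (j + 1) ≤ a * u j) : ∃ C > 0, ∀ j, u j ≤ C * a ^ j := by
  obtain ⟨N, hN⟩ := eventually_atTop.1 h
  have hO : u =O[atTop] fun j => a ^ j := by
    refine .of_bound (u N / a ^ N) (eventually_atTop.2 ⟨N, fun j hj => ?_⟩)
    obtain ⟨i, rfl⟩ := Nat.exists_eq_add_of_le hj
    have hgeom : u (N + i) ≤ a ^ i * u N :=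
      le_geom (u := fun i => u (N + i)) ha.le i fun l _ => hN (N + l) (Nat.le_add_right N l)
    rw [Real.norm_of_nonneg (hu _), Real.norm_of_nonneg (by positivity), pow_add]
    field_simp
    linarith
  obtain ⟨C, hC, hbound⟩ := Asymptotics.bound_of_isBigO_nat_atTop hO
  refine ⟨C, hC, fun j => (Real.le_norm_self _).trans ?_⟩
  simpa [abs_of_pos ha] using hbound (pow_pos ha j).ne'

theorem mul_le_of_geometric_tails {k : ℤ → ℝ} (hk : ∀ n, 0 ≤ k n) {C a b R t : ℝ} (hC : 0 ≤ C)
    (ha : 0 ≤ a) (hb : 0 ≤ b) (hbR : b ≤ R) (haR : a ≤ R * t) (hat : a ≤ t) (hbt : b ≤ t)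
    (ht : t ≤ 1) (hpos : ∀ j : ℕ, k j ≤ C * b ^ j) (hneg : ∀ j : ℕ, k (-j) ≤ C * a ^ j)
    (m : ℤ) (n : ℕ) : k m * k (m + n) ≤ C ^ 2 * (R ^ n * t ^ m.natAbs) := by
  have ht0 : 0 ≤ t := ha.trans hat
  have hR0 : 0 ≤ R := hb.trans hbR
  obtain ⟨j, rfl | rfl⟩ := m.eq_nat_or_neg
  · have hjn : k (j + n) ≤ C * b ^ (j + n) := by exact_mod_cast hpos (j + n)
    calc k j * k (j + n) ≤ (C * b ^ j) * (C * b ^ (j + n)) :=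
          mul_le_mul (hpos j) hjn (hk _) (by positivity)
      _ = C ^ 2 * (b ^ n * (b ^ j * b ^ j)) := by ring
      _ ≤ C ^ 2 * (R ^ n * (t ^ j * 1)) := by
          gcongr
          exact pow_le_one₀ hb (hbt.trans ht)
      _ = C ^ 2 * (R ^ n * t ^ (j : ℤ).natAbs) := by simp
  rw [Int.natAbs_neg, Int.natAbs_natCast]
  rcases le_total j n with hjn | hjn
  · obtain ⟨i, rfl⟩ := Nat.exists_eq_add_of_le hjn
    rw [show -(j : ℤ) + ((j + i : ℕ) : ℤ) = i by push_cast; ring]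
    calc k (-j) * k i ≤ (C * a ^ j) * (C * b ^ i) :=
          mul_le_mul (hneg j) (hpos i) (hk _) (by positivity)
      _ ≤ (C * (R * t) ^ j) * (C * R ^ i) := by gcongr
      _ = C ^ 2 * (R ^ (j + i) * t ^ j) := by ring
  · obtain ⟨i, rfl⟩ := Nat.exists_eq_add_of_le hjn
    rw [show -((n + i : ℕ) : ℤ) + (n : ℤ) = -i by push_cast; ring]
    calc k (-((n + i : ℕ) : ℤ)) * k (-i) ≤ (C * a ^ (n + i)) * (C * a ^ i) :=
          mul_le_mul (hneg _) (hneg i) (hk _) (by positivity)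
      _ = C ^ 2 * (a ^ n * a ^ i * a ^ i) := by ring
      _ ≤ C ^ 2 * ((R * t) ^ n * t ^ i * 1) := by
          gcongr
          exact pow_le_one₀ ha (hat.trans ht)
      _ = C ^ 2 * (R ^ n * t ^ (n + i)) := by ring

theorem summable_pow_natAbs_rpow {t s : ℝ} (ht0 : 0 ≤ t) (ht1 : t < 1) (hs : 0 < s) :
    Summable fun m : ℤ => (t ^ m.natAbs) ^ s := by
  have hgeom : Summable fun j : ℕ => (t ^ j) ^ s := by
    simpa only [Real.rpow_pow_comm ht0] using
      summable_geometric_of_lt_one (Real.rpow_nonneg ht0 s) (Real.rpow_lt_one ht0 ht1 hs)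
  exact .of_nat_of_neg (by simpa using hgeom) (by simpa using hgeom)

variable {ω : ℤ → ℝ} {k₀ ηm ηp : ℝ}

theorem weightSeq_pos (hω : ∀ n, 0 < ω n) (hk₀ : 0 < k₀) (n : ℤ) : 0 < weightSeq ω k₀ n := by
  unfold weightSeq
  split_ifs
  · exact mul_pos hk₀ (Finset.prod_pos fun l _ => one_div_pos.2 (hω l))
  · exact mul_pos hk₀ (Finset.prod_pos fun l _ => hω l)

theorem weightSeq_succ (hω : ∀ n, ω n ≠ 0) (k₀ : ℝ) (n : ℤ) :
    weightSeq ω k₀ (n + 1) = ω (n + 1) * weightSeq ω k₀ n := by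
  rcases lt_trichotomy n (-1) with h | rfl | h
  · rw [weightSeq, weightSeq, if_pos (by omega), if_pos (by omega),
      ← Finset.insert_Icc_add_one_left_eq_Icc (show n + 1 ≤ 0 by omega),
      Finset.prod_insert (by simp)]
    field_simp [hω (n + 1)]
  · rw [weightSeq, weightSeq, if_neg (by omega), if_pos le_rfl, neg_add_cancel,
      Finset.Icc_eq_empty (by omega), Finset.Icc_self, Finset.prod_empty, Finset.prod_singleton,
      mul_left_comm, mul_one_div_cancel (hω 0)]
  · rw [weightSeq, weightSeq, if_neg (by omega), if_neg (by omega),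
      ← Finset.insert_Icc_right_eq_Icc_add_one (show (1 : ℤ) ≤ n + 1 by omega),
      Finset.prod_insert (by simp)]
    ring

theorem exists_weightSeq_natCast_le (hω : ∀ n, 0 < ω n) (hk₀ : 0 < k₀)
    (hp : ∀ᶠ l in atTop, ω l ≤ ηp) : ∃ C > 0, ∀ j : ℕ, weightSeq ω k₀ j ≤ C * ηp ^ j := by
  have hηp : 0 < ηp := let ⟨l, hl⟩ := hp.exists; (hω l).trans_le hl
  refine exists_pos_forall_le_mul_pow (fun j => (weightSeq_pos hω hk₀ j).le) hηp ?_
  have hshift : Tendsto (fun j : ℕ => (j : ℤ) + 1) atTop atTop :=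
    tendsto_atTop_add_const_right _ 1 tendsto_natCast_atTop_atTop
  filter_upwards [hshift.eventually hp] with j hj
  rw [Nat.cast_succ, weightSeq_succ fun n => (hω n).ne']
  exact mul_le_mul_of_nonneg_right hj (weightSeq_pos hω hk₀ j).le

theorem exists_weightSeq_neg_natCast_le (hω : ∀ n, 0 < ω n) (hk₀ : 0 < k₀)
    (hm : ∀ᶠ l in atBot, 1 / ω l ≤ ηm) :
    ∃ C > 0, ∀ j : ℕ, weightSeq ω k₀ (-j) ≤ C * ηm ^ j := by
  have hηm : 0 < ηm := let ⟨l, hl⟩ := hm.exists; (one_div_pos.2 (hω l)).trans_le hl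
  refine exists_pos_forall_le_mul_pow (u := fun j : ℕ => weightSeq ω k₀ (-j))
    (fun j => (weightSeq_pos hω hk₀ _).le) hηm ?_
  have hneg : Tendsto (fun j : ℕ => -(j : ℤ)) atTop atBot :=
    tendsto_neg_atTop_atBot.comp tendsto_natCast_atTop_atTop
  filter_upwards [hneg.eventually hm] with j hj
  have hsucc := weightSeq_succ (fun n => (hω n).ne') k₀ (-((j + 1 : ℕ) : ℤ))
  rw [show -((j + 1 : ℕ) : ℤ) + 1 = -j by push_cast; ring] at hsucc
  rw [hsucc, ← mul_assoc]
  exact le_mul_of_one_le_left (weightSeq_pos hω hk₀ _).le ((div_le_iff₀ (hω _)).1 hj)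

theorem exists_weightSeq_mul_le (hω : ∀ n, 0 < ω n) (hk₀ : 0 < k₀)
    (hm : ∀ᶠ l in atBot, 1 / ω l ≤ ηm) (hm1 : ηm < 1) (hp : ∀ᶠ l in atTop, ω l ≤ ηp)
    (hp1 : ηp < 1) {R : ℝ} (hmR : ηm < R) (hpR : ηp ≤ R) :
    ∃ C t : ℝ, 0 < C ∧ 0 ≤ t ∧ t < 1 ∧ ∀ (m : ℤ) (n : ℕ),
      weightSeq ω k₀ m * weightSeq ω k₀ (m + n) ≤ C * (R ^ n * t ^ m.natAbs) := by
  have hηm : 0 < ηm := let ⟨l, hl⟩ := hm.exists; (one_div_pos.2 (hω l)).trans_le hl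
  have hηp : 0 < ηp := let ⟨l, hl⟩ := hp.exists; (hω l).trans_le hl
  have hR : 0 < R := hηm.trans hmR
  obtain ⟨C₁, hC₁, hpos⟩ := exists_weightSeq_natCast_le hω hk₀ hp
  obtain ⟨C₂, -, hneg⟩ := exists_weightSeq_neg_natCast_le hω hk₀ hm
  have hC : 0 < max C₁ C₂ := lt_max_of_lt_left hC₁
  set t := max (max ηm ηp) (ηm / R)
  have hmt : ηm ≤ t := (le_max_left _ _).trans (le_max_left _ _)
  have hpt : ηp ≤ t := (le_max_right _ _).trans (le_max_left _ _)
  have hmRt : ηm ≤ R * t := (div_le_iff₀' hR).1 (le_max_right _ _)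
  have ht1 : t < 1 := max_lt (max_lt hm1 hp1) ((div_lt_one hR).2 hmR)
  refine ⟨max C₁ C₂ ^ 2, t, by positivity, hηm.le.trans hmt, ht1,
    mul_le_of_geometric_tails (fun n => (weightSeq_pos hω hk₀ n).le) hC.le hηm.le hηp.le hpR hmRt
      hmt hpt ht1.le (fun j => (hpos j).trans ?_) (fun j => (hneg j).trans ?_)⟩
  · gcongr
    exact le_max_left _ _
  · gcongr
    exact le_max_right _ _

end Weights

section WeightedShift

variable {p : ℝ≥0} [Fact (1 ≤ (p : ℝ≥0∞))] {ω : ℤ → ℝ} {k₀ : ℝ} {T : EllP p →L[ℂ] EllP p}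

theorem shift_weightedBasisVec (hω : ∀ n, ω n ≠ 0)
    (hT : ∀ n : ℤ, T (basisVec p n) = (ω (n + 1) : ℂ) • basisVec p (n + 1)) (m : ℤ) :
    T (weightedBasisVec p (weightSeq ω k₀) m) = weightedBasisVec p (weightSeq ω k₀) (m + 1) := by
  rw [weightedBasisVec, weightedBasisVec, map_smul, hT, smul_smul, weightSeq_succ hω,
    Complex.ofReal_mul, mul_comm]

theorem shift_pow_weightedBasisVec (hω : ∀ n, ω n ≠ 0)
    (hT : ∀ n : ℤ, T (basisVec p n) = (ω (n + 1) : ℂ) • basisVec p (n + 1)) (n : ℕ) (m : ℤ) :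
    (T ^ n) (weightedBasisVec p (weightSeq ω k₀) m)
      = weightedBasisVec p (weightSeq ω k₀) (m + n) := by
  induction n with
  | zero => simp
  | succ n ih =>
    rw [pow_succ', mul_apply_eq_comp, ih, shift_weightedBasisVec hω hT,
      Nat.cast_succ, add_assoc]

variable [MeasurableSpace (EllP p)] [BorelSpace (EllP p)] {α : ℝ} {μ : Measure (EllP p)}

theorem stableExponent_comp_shift (hα : 0 ≤ α) (hω : ∀ n, 0 < ω n) (hk₀ : 0 < k₀)
    (hk : Summable fun n => weightSeq ω k₀ n ^ α)
    (hT : ∀ n : ℤ, T (basisVec p n) = (ω (n + 1) : ℂ) • basisVec p (n + 1))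
    (x : StrongDual ℂ (EllP p)) :
    stableExponent α (controlMeasure p α (weightSeq ω k₀)) (x.comp T)
      = stableExponent α (controlMeasure p α (weightSeq ω k₀)) x := by
  have hk0 (n : ℤ) := (weightSeq_pos hω hk₀ n).le
  rw [stableExponent_controlMeasure hα hk0 hk, stableExponent_controlMeasure hα hk0 hk,
    ← (Equiv.addRight (1 : ℤ)).tsum_eq
      fun n => (|(x (weightedBasisVec p (weightSeq ω k₀) n)).re| ^ α + _) / 2]
  simp only [ContinuousLinearMap.comp_apply, map_smul,
    shift_weightedBasisVec (fun n => (hω n).ne') hT, Equiv.coe_addRight]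

theorem IsStableWithControl.measurePreserving_shift [IsFiniteMeasure μ] (hα : 0 ≤ α)
    (hω : ∀ n, 0 < ω n) (hk₀ : 0 < k₀) (hk : Summable fun n => weightSeq ω k₀ n ^ α)
    (hμ : IsStableWithControl α (controlMeasure p α (weightSeq ω k₀)) μ)
    (hT : ∀ n : ℤ, T (basisVec p n) = (ω (n + 1) : ℂ) • basisVec p (n + 1)) :
    MeasurePreserving T μ μ :=
  measurePreserving_of_charFunctional_comp fun x => by
    rw [hμ.charFunctional_eq, hμ.charFunctional_eq, stableExponent_comp_shift hα hω hk₀ hk hT]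

variable {ηm ηp : ℝ}

theorem IsStableWithControl.exists_norm_codiffEq_adjPow_le (hα0 : 0 < α) (hα2 : α ≤ 2)
    (hω : ∀ n, 0 < ω n) (hk₀ : 0 < k₀) (hk : Summable fun n => weightSeq ω k₀ n ^ α)
    (hμ : IsStableWithControl α (controlMeasure p α (weightSeq ω k₀)) μ)
    (hT : ∀ n : ℤ, T (basisVec p n) = (ω (n + 1) : ℂ) • basisVec p (n + 1))
    (hm : ∀ᶠ l in atBot, 1 / ω l ≤ ηm) (hm1 : ηm < 1) (hp : ∀ᶠ l in atTop, ω l ≤ ηp)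
    (hp1 : ηp < 1) {R : ℝ} (hmR : ηm < R) (hpR : ηp ≤ R) :
    ∃ K > 0, ∀ (n : ℕ) (x y : StrongDual ℂ (EllP p)),
      ‖codiffEq μ x (adjPow T n y)‖
        ≤ K * R ^ (α * n / 2) * (‖x‖ ^ (α / 2) * ‖y‖ ^ (α / 2)) := by
  have hk0 (n : ℤ) := (weightSeq_pos hω hk₀ n).le
  have hR : 0 ≤ R := let ⟨l, hl⟩ := hp.exists; (hω l).le.trans (hl.trans hpR)
  obtain ⟨C, t, hC, ht0, ht1, hbound⟩ := exists_weightSeq_mul_le hω hk₀ hm hm1 hp hp1 hmR hpR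
  have hsum : Summable fun m : ℤ => (t ^ m.natAbs) ^ (α / 2) :=
    summable_pow_natAbs_rpow ht0 ht1 (half_pos hα0)
  have hsum_pos : 0 < ∑' m : ℤ, (t ^ m.natAbs) ^ (α / 2) :=
    hsum.tsum_pos (fun m => by positivity) 0 (by simp)
  refine ⟨2 * C ^ (α / 2) * ∑' m : ℤ, (t ^ m.natAbs) ^ (α / 2), by positivity,
    fun n x y => ?_⟩
  have hterm (m : ℤ) : ‖x (weightedBasisVec p (weightSeq ω k₀) m)‖
      * ‖adjPow T n y (weightedBasisVec p (weightSeq ω k₀) m)‖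
        ≤ C * R ^ n * (‖x‖ * ‖y‖) * t ^ m.natAbs := by
    rw [adjPow, ContinuousLinearMap.comp_apply,
      shift_pow_weightedBasisVec (fun n => (hω n).ne') hT]
    calc _ ≤ (weightSeq ω k₀ m * ‖x‖) * (weightSeq ω k₀ (m + n) * ‖y‖) := by
          gcongr
          · exact mul_nonneg (hk0 m) (norm_nonneg x)
          · exact norm_apply_weightedBasisVec_le hk0 x m
          · exact norm_apply_weightedBasisVec_le hk0 y (m + n)
      _ = weightSeq ω k₀ m * weightSeq ω k₀ (m + n) * (‖x‖ * ‖y‖) := by ring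
      _ ≤ C * (R ^ n * t ^ m.natAbs) * (‖x‖ * ‖y‖) := by gcongr ?_ * _; exact hbound m n
      _ = C * R ^ n * (‖x‖ * ‖y‖) * t ^ m.natAbs := by ring
  have hsplit (m : ℤ) : (C * R ^ n * (‖x‖ * ‖y‖) * t ^ m.natAbs) ^ (α / 2)
      = C ^ (α / 2) * R ^ (α * n / 2) * (‖x‖ ^ (α / 2) * ‖y‖ ^ (α / 2))
        * (t ^ m.natAbs) ^ (α / 2) := by
    rw [Real.mul_rpow (by positivity) (by positivity), Real.mul_rpow (by positivity)
      (by positivity), Real.mul_rpow hC.le (by positivity), Real.mul_rpow (norm_nonneg x)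
      (norm_nonneg y), ← Real.rpow_natCast_mul hR, mul_comm (n : ℝ), div_mul_eq_mul_div]
  have hle := hμ.norm_codiffEq_le_tsum hα0.le hα2 hk0 hk hterm
    (by simpa only [hsplit] using hsum.mul_left _)
  simp only [hsplit, tsum_mul_left] at hle
  exact hle.trans_eq (by ring)

theorem IsStableWithControl.isMixing_shift [IsProbabilityMeasure μ] (hα0 : 0 < α) (hα2 : α ≤ 2)
    (hω : ∀ n, 0 < ω n) (hk₀ : 0 < k₀) (hk : Summable fun n => weightSeq ω k₀ n ^ α)
    (hμ : IsStableWithControl α (controlMeasure p α (weightSeq ω k₀)) μ)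
    (hT : ∀ n : ℤ, T (basisVec p n) = (ω (n + 1) : ℂ) • basisVec p (n + 1))
    (hm : ∀ᶠ l in atBot, 1 / ω l ≤ ηm) (hm1 : ηm < 1) (hp : ∀ᶠ l in atTop, ω l ≤ ηp)
    (hp1 : ηp < 1) : IsMixing T μ := by
  obtain ⟨R, hηR, hR1⟩ := exists_between (max_lt hm1 hp1)
  obtain ⟨hmR, hpR⟩ := max_lt_iff.1 hηR
  have hR : 0 ≤ R := let ⟨l, hl⟩ := hp.exists; (hω l).le.trans (hl.trans hpR.le)
  obtain ⟨K, -, hK⟩ := hμ.exists_norm_codiffEq_adjPow_le hα0 hα2 hω hk₀ hk hT hm hm1 hp hp1 hmR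
    hpR.le
  have hdecay : Tendsto (fun n : ℕ => R ^ (α * n / 2)) atTop (𝓝 0) := by
    have hpow : ∀ n : ℕ, R ^ (α * n / 2) = (R ^ (α / 2)) ^ n := fun n => by
      rw [← Real.rpow_mul_natCast hR, div_mul_eq_mul_div]
    simp only [hpow]
    exact tendsto_pow_atTop_nhds_zero_of_lt_one (Real.rpow_nonneg hR _)
      (Real.rpow_lt_one hR hR1 (half_pos hα0))
  refine isMixing_of_tendsto_codiffEq (hμ.measurePreserving_shift hα0.le hω hk₀ hk hT)
    hμ.charFunctional_ne_zero fun x y => squeeze_zero_norm (fun n => hK n x y) ?_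
  simpa using (hdecay.const_mul K).mul_const (‖x‖ ^ (α / 2) * ‖y‖ ^ (α / 2))

end WeightedShift

theorem lt_rpow_two_mul_div_sub_one {η α q : ℝ} (hη0 : 0 < η) (hη1 : η < 1) (hα : 0 < α)
    (hαq : α < q) : η < η ^ (2 * α / q - 1) := by
  have hexp : 2 * α / q - 1 < 1 := by
    rw [sub_lt_iff_lt_add, div_lt_iff₀ (hα.trans hαq)]
    linarith
  simpa using Real.rpow_lt_rpow_of_exponent_gt hη0 hη1 hexp

theorem proposition5p2_general
    (p : ℝ≥0) [Fact (1 ≤ (p : ℝ≥0∞))]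
    [MeasurableSpace (EllP p)] [BorelSpace (EllP p)]
    (α : ℝ) (hα0 : 0 < α) (hα2 : α ≤ 2)
    (ω : ℤ → ℝ) (hω : ∀ n, 0 < ω n)
    (k₀ : ℝ) (hk₀ : 0 < k₀)
    (hk : Memℓp (weightSeq ω k₀) (ENNReal.ofReal α))
    (μ : Measure (EllP p)) [IsProbabilityMeasure μ]
    (hμ : IsStableWithControl α (controlMeasure p α (weightSeq ω k₀)) μ)
    (T : EllP p →L[ℂ] EllP p)
    (hT : ∀ n : ℤ, T (basisVec p n) = (ω (n + 1) : ℂ) • basisVec p (n + 1)) :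
    MeasurePreserving T μ μ ∧
    ∀ ηm ηp : ℝ, (∀ᶠ l in atBot, 1 / ω l ≤ ηm) → ηm < 1 → (∀ᶠ l in atTop, ω l ≤ ηp) → ηp < 1 →
      (∀ R : ℝ, ηm < R → ηp ≤ R →
        ∃ K : ℝ, 0 < K ∧ ∀ n : ℕ, ∀ x y : StrongDual ℂ (EllP p), x ≠ 0 → y ≠ 0 →
          ‖codiffEq μ x (adjPow T n y)‖ / (‖x‖ ^ (α / 2) * ‖y‖ ^ (α / 2))
              ≤ K * R ^ (α * (n : ℝ) / 2) ∧
          ‖codiffNe μ x (adjPow T n y)‖ / (‖x‖ ^ (α / 2) * ‖y‖ ^ (α / 2))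
              ≤ K * R ^ (α * (n : ℝ) / 2)) ∧
      IsMixing T μ := by
  have hsum : Summable fun n => weightSeq ω k₀ n ^ α := by
    simpa [ENNReal.toReal_ofReal hα0.le, abs_of_pos (weightSeq_pos hω hk₀ _)] using
      (memℓp_gen_iff (by rwa [ENNReal.toReal_ofReal hα0.le])).1 hk
  refine ⟨hμ.measurePreserving_shift hα0.le hω hk₀ hsum hT, fun ηm ηp hm hm1 hp hp1 =>
    ⟨fun R hmR hpR => ?_, hμ.isMixing_shift hα0 hα2 hω hk₀ hsum hT hm hm1 hp hp1⟩⟩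
  obtain ⟨K, hK0, hK⟩ := hμ.exists_norm_codiffEq_adjPow_le hα0 hα2 hω hk₀ hsum hT hm hm1 hp hp1
    hmR hpR
  refine ⟨K, hK0, fun n x y hx hy => ?_⟩
  have hxy : 0 < ‖x‖ ^ (α / 2) * ‖y‖ ^ (α / 2) := by positivity
  have hNe : codiffNe μ x (adjPow T n y) = codiffEq μ x (adjPow T n (-(Complex.I • y))) :=
    codiffNe_eq_codiffEq μ x _
  rw [div_le_iff₀ hxy, div_le_iff₀ hxy, hNe]
  exact ⟨hK n x y, by simpa [norm_smul] using hK n x (-(Complex.I • y))⟩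

theorem proposition5p2
    (p : ℝ≥0) [Fact (1 ≤ (p : ℝ≥0∞))]
    [MeasurableSpace (EllP p)] [BorelSpace (EllP p)]
    (α : ℝ) (hα0 : 0 < α) (hα2 : α < 2) (hα1 : α ≠ 1)
    (ω : ℤ → ℝ) (hω : ∀ n, 0 < ω n)
    (k₀ : ℝ) (hk₀ : 0 < k₀)
    (hk : Memℓp (weightSeq ω k₀) (ENNReal.ofReal α))
    (μ : Measure (EllP p)) [IsProbabilityMeasure μ]
    (hμ : IsStableWithControl α (controlMeasure p α (weightSeq ω k₀)) μ)
    (T : EllP p →L[ℂ] EllP p)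
    (hT : ∀ n : ℤ, T (basisVec p n) = (ω (n + 1) : ℂ) • basisVec p (n + 1)) :
    MeasurePreserving T μ μ ∧
    (α < p → (p : ℝ) ≤ 2 →
      ∀ (qm qp : ℕ), 1 ≤ qp →
      ∀ (ηm ηp : ℝ),
        IsLUB {r : ℝ | ∃ l : ℤ, l ≤ -(qm : ℤ) ∧ r = 1 / ω l} ηm → ηm < 1 →
        IsLUB {r : ℝ | ∃ l : ℤ, (qp : ℤ) ≤ l ∧ r = ω l} ηp → ηp < 1 →
        ηp ^ ((p : ℝ) / 2) ≠ ηm ^ (α - (p : ℝ) / 2) →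
        (∃ K : ℝ, 0 < K ∧ ∀ n : ℕ, ∀ x y : StrongDual ℂ (EllP p), x ≠ 0 → y ≠ 0 →
          ‖codiffEq μ x (adjPow T n y)‖ / (‖x‖ ^ (α / 2) * ‖y‖ ^ (α / 2))
              ≤ K * max (ηm ^ (2 * α / (p : ℝ) - 1)) ηp ^ (α * (n : ℝ) / 2) ∧
          ‖codiffNe μ x (adjPow T n y)‖ / (‖x‖ ^ (α / 2) * ‖y‖ ^ (α / 2))
              ≤ K * max (ηm ^ (2 * α / (p : ℝ) - 1)) ηp ^ (α * (n : ℝ) / 2)) ∧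
        (1 / 2 < α → (p : ℝ) < 2 * α → IsMixing T μ)) := by
  have h := proposition5p2_general p α hα0 hα2.le ω hω k₀ hk₀ hk μ hμ T hT
  refine ⟨h.1, fun hαp _ qm qp _ ηm ηp hm hm1 hp hp1 _ => ?_⟩
  have hηm : 0 < ηm := (one_div_pos.2 (hω _)).trans_le (hm.1 ⟨-(qm : ℤ), le_rfl, rfl⟩)
  have hbot : ∀ᶠ l in atBot, 1 / ω l ≤ ηm :=
    (eventually_le_atBot (-(qm : ℤ))).mono fun l hl => hm.1 ⟨l, hl, rfl⟩
  have htop : ∀ᶠ l in atTop, ω l ≤ ηp :=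
    (eventually_ge_atTop (qp : ℤ)).mono fun l hl => hp.1 ⟨l, hl, rfl⟩
  obtain ⟨hrate, hmix⟩ := h.2 ηm ηp hbot hm1 htop hp1
  exact ⟨hrate _ (lt_max_of_lt_left (lt_rpow_two_mul_div_sub_one hηm hm1 hα0 hαp))
    (le_max_right _ _), fun _ _ => hmix⟩
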